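/- Let $m\ge 0$ be an integer and let $\mathcal{G}$ be a finite collection of colored chains: each member of $\mathcal{G}$ is a finite sequence $(i_1\prec i_2\prec\cdots\prec i_\ell)$ of colors $i_j\in\{1,\ldots,m\}$ with $\ell\ge 2$. A colored subset of $\mathcal{P}([n])$ is a set $S\subseteq\mathcal{P}([n])$ together with a coloring $c:S\to\{1,\ldots,m\}$; it is valid if there are no $(i_1\prec\cdots\prec i_\ell)\in\mathcal{G}$ and $x_1\subsetneq\cdots\subsetneq x_\ell$ in $S$ with $c(x_j)=i_j$ for all $1\le j\le\ell$. Let $\Lambda(\mathcal{G},n)$ be the set of valid colored subsets of $\mathcal{P}([n])$. A template is a function $T:\mathcal{P}([n])\to\mathcal{P}(\{1,\ldots,m\})$; its support is $\mathrm{Supp}(T)=\{x : T(x)\ne\emptyset\}$, and its weight is $\omega(T)=\sum_{x\in\mathcal{P}([n])}\log(1+|T(x)|)$. It is valid if every coloring $c$ of $\mathrm{Supp}(T)$ with $c(x)\in T(x)$ for all $x\in\mathrm{Supp}(T)$ is valid, and it is supported on $A\subseteq\mathcal{P}([n])$ if $\mathrm{Supp}(T)\subseteq A$. Theorem. Suppose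 that $\mathcal{G}$ is sparse, that is, for every color $i\in\{1,\ldots,m\}$ it contains a chain all of whose elements have color $i$. Then the maximum $$\omega_{crit}=\max\{\omega(T) : T \text{ a valid template on } \mathcal{P}([r]) \text{ for some } r\ge 0, \text{ supported on a chain of } \mathcal{P}([r])\}$$ exists (it is a constant that depends only on $\mathcal{G}$ and $m$), and as $n\to\infty$ $$|\Lambda(\mathcal{G},n)| = e^{\omega_{crit}\binom{n}{\lfloor n/2\rfloor}(1+o(1))}.$$ -/

import Mathlib

namespace ColoredChains

/-- A colored subset of `P` with colors `Fin m`: a subset `S` of `P` together with a map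
`S → Fin m`, encoded as `c : P → Option (Fin m)`, where `c x = none` means `x ∉ S` and
`c x = some i` means that `x ∈ S` has color `i`. -/
abbrev ColoredSubset (P : Type*) (m : ℕ) := P → Option (Fin m)

/-- A colored chain poset `i₁ ≺ i₂ ≺ ⋯ ≺ i_ℓ` is the list `[i₁, …, i_ℓ]` of its colors, from
bottom to top.  It appears in a colored subset if there are `x₁ < x₂ < ⋯ < x_ℓ` such that
each `x_j` belongs to the colored subset and has color `i_j`. -/
def Appears {P : Type*} [PartialOrder P] {m : ℕ} (g : List (Fin m)) (c : ColoredSubset P m) :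
    Prop :=
  ∃ x : Fin g.length → P, StrictMono x ∧ ∀ j, c (x j) = some (g.get j)

/-- A colored subset is valid with respect to `G` if no member of `G` appears in it. -/
def IsValid {P : Type*} [PartialOrder P] {m : ℕ} (G : Finset (List (Fin m)))
    (c : ColoredSubset P m) : Prop :=
  ∀ g ∈ G, ¬ Appears g c

/-- The collection of validly colored subsets of the Boolean lattice on `n` points. -/
def Lam {m : ℕ} (G : Finset (List (Fin m))) (n : ℕ) :
    Set (ColoredSubset (Finset (Fin n)) m) :=
  {c | IsValid G c}

/-- A template on the Boolean lattice assigns to every set a set of colors. -/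
abbrev Template (n m : ℕ) := Finset (Fin n) → Finset (Fin m)

namespace Template

variable {n m : ℕ}

/-- `T` is supported on `A` if `T x = ∅` for all `x ∉ A`. -/
def SupportedOn (T : Template n m) (A : Set (Finset (Fin n))) : Prop :=
  ∀ x, x ∉ A → T x = ∅

/-- The smallest set on which `T` is supported. -/
def Supp (T : Template n m) : Set (Finset (Fin n)) :=
  {x | T x ≠ ∅}

/-- `c` is a coloring of exactly the set `Supp T`, with the color of each `x` taken from `T x`. -/
def IsColoring (T : Template n m) (c : ColoredSubset (Finset (Fin n)) m) : Prop :=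
  (∀ x ∈ T.Supp, ∃ i ∈ T x, c x = some i) ∧ ∀ x ∉ T.Supp, c x = none

/-- A template is valid if all colorings of its support taken from it are valid. -/
def Valid (G : Finset (List (Fin m))) (T : Template n m) : Prop :=
  ∀ c, T.IsColoring c → IsValid G c

/-- The weight of a template. -/
noncomputable def omega (T : Template n m) : ℝ :=
  ∑ x, Real.log (1 + ((T x).card : ℝ))

end Template

/-- The weights of all valid templates, on Boolean lattices of any size, that are supported on
a chain. -/
def critWeights {m : ℕ} (G : Finset (List (Fin m))) : Set ℝ :=
  {w | ∃ (n : ℕ) (T : Template n m) (A : Set (Finset (Fin n))),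
    T.Valid G ∧ IsChain (· ⊆ ·) A ∧ T.SupportedOn A ∧ w = T.omega}

/-- `G` is sparse: it contains a monochromatic chain of every color. -/
def IsSparse {m : ℕ} (G : Finset (List (Fin m))) : Prop :=
  ∀ i : Fin m, ∃ g ∈ G, ∀ j ∈ g, j = i

/-- The critical weight, the largest element of `critWeights G`. -/
noncomputable def omegaCrit {m : ℕ} (G : Finset (List (Fin m))) : ℝ :=
  sSup (critWeights G)

end ColoredChains

/-!
Upper bound. Every valid colored subset `c` of the Boolean lattice contains a small *fingerprint*:
a colored subset `F ⊆ c` such that all colors of `c` lie in the *container* of `F`, the template of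
the colors that complete no member of `G` together with `F` and create few new suffixes of members
of `G` below. Along a random maximal chain few sets create a new suffix. Between two consecutive
ones the container is a valid template, so its weight there is at most `ω_crit`; averaging over all
maximal chains gives total weight at most `(ω_crit + o(1)) * n.choose (n / 2)`. Fingerprints are few
because each of their elements raises by a constant a potential of total size `O(2 ^ n / n)`.

Lower bound. An optimal template on a chain is spread over the layers just above the middle, all of
which have size asymptotic to `n.choose (n / 2)`. Such a template exists because a sparse `G` bounds
the number of sets on a chain that may be given each color.
-/

namespace ColoredChains

open Finset

section Occurrence

variable {P ι : Type*} [Preorder P] {R R' S : P → ι → Prop} {g p : List ι} {i : ι} {x y : P}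

/-- The chain of colors `g` occurs in the relation `R` (read: `x` may have color `i`) if there are
`x₁ < ⋯ < x_ℓ` such that each `x_j` is related to the `j`-th color of `g`. Colored subsets and
templates are both treated through such relations. -/
def Occurs (R : P → ι → Prop) (g : List ι) : Prop :=
  ∃ x : Fin g.length → P, StrictMono x ∧ ∀ j, R (x j) (g.get j)

/-- The chain of colors `g` occurs in `R` strictly above `x`. -/
def OccursAbove (R : P → ι → Prop) (g : List ι) (x : P) : Prop :=
  Occurs (fun y i => x < y ∧ R y i) g

/-- The relation that `x` belongs to the colored subset `c` and has color `i`. -/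
abbrev HasColor (c : P → Option ι) (x : P) (i : ι) : Prop := c x = some i

/-- The relation that `i` is one of the colors that the template `T` assigns to `x`. -/
abbrev Allows (T : P → Finset ι) (x : P) (i : ι) : Prop := i ∈ T x

lemma Occurs.mono (hR : R ≤ R') : Occurs R g → Occurs R' g
  | ⟨x, hx, hxg⟩ => ⟨x, hx, fun j => hR _ _ (hxg j)⟩

lemma OccursAbove.mono (hR : R ≤ R') (hyx : y ≤ x) (h : OccursAbove R g x) :
    OccursAbove R' g y :=
  Occurs.mono (fun _ _ hz => ⟨hyx.trans_lt hz.1, hR _ _ hz.2⟩) h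

lemma occurs_nil : Occurs R [] :=
  ⟨Fin.elim0, fun j => j.elim0, fun j => j.elim0⟩

lemma occurs_cons : Occurs R (i :: g) ↔ ∃ z, R z i ∧ OccursAbove R g z := by
  constructor
  · rintro ⟨y, hy, hR⟩
    exact ⟨y ⟨0, by simp⟩, hR ⟨0, by simp⟩, fun j => y j.succ,
      fun a b hab => hy (Fin.succ_lt_succ_iff.2 hab), fun j => ⟨hy (Fin.succ_pos j), hR j.succ⟩⟩
  · rintro ⟨z, hz, y, hy, hR⟩
    exact ⟨(Fin.cons z y : Fin (g.length + 1) → P),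
      Fin.strictMono_cons.2 ⟨fun j => (hR j).1, hy⟩, Fin.cases hz fun j => (hR j).2⟩

lemma occursAbove_cons :
    OccursAbove R (i :: g) x ↔ ∃ z, x < z ∧ R z i ∧ OccursAbove R g z := by
  rw [OccursAbove, occurs_cons]
  refine exists_congr fun z => ?_
  rw [and_assoc]
  refine and_congr_right fun hxz => and_congr_right fun _ => ?_
  exact ⟨Occurs.mono fun y i hy => ⟨hy.1, hy.2.2⟩,
    Occurs.mono fun y i hy => ⟨hy.1, hxz.trans hy.1, hy.2⟩⟩

lemma OccursAbove.transfer {B : Set P} (hSB : ∀ z i, S z i → z ∈ B)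
    (hSR : ∀ x ∈ B, ∀ z i p, x < z → S z i → i :: p <:+ g → OccursAbove R p z →
      OccursAbove R (i :: p) x)
    (hp : p <:+ g) (hx : x ∈ B) (h : OccursAbove S p x) : OccursAbove R p x := by
  induction p generalizing x with
  | nil => exact occurs_nil
  | cons i p ih =>
    obtain ⟨z, hxz, hz, hpz⟩ := occursAbove_cons.1 h
    exact hSR x hx z i p hxz hz hp (ih ((List.suffix_cons i p).trans hp) (hSB z i hz) hpz)

end Occurrence

section Chain

lemma exists_strictMono_of_isChain {P : Type*} [PartialOrder P] {B : Finset P}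
    (hB : IsChain (· ≤ ·) (B : Set P)) {ℓ : ℕ} (hℓ : ℓ ≤ #B) :
    ∃ x : Fin ℓ → P, StrictMono x ∧ ∀ j, x j ∈ B := by
  classical
  let : LinearOrder B := hB.linearOrder
  let e : Fin ℓ ↪o B := (univ : Finset B).orderEmbOfCardLe (by simpa using hℓ)
  exact ⟨fun j => e j, fun _ _ hab => e.strictMono hab, fun j => (e j).2⟩

lemma card_lt_length_of_not_occurs {P ι : Type*} [PartialOrder P] {R : P → ι → Prop} {i : ι}
    {g : List ι} (hgi : ∀ j ∈ g, j = i) (hg : ¬ Occurs R g) {B : Finset P}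
    (hB : IsChain (· ≤ ·) (B : Set P)) (hBi : ∀ x ∈ B, R x i) : #B < g.length := by
  by_contra! hlen
  obtain ⟨x, hx, hxB⟩ := exists_strictMono_of_isChain hB hlen
  exact hg ⟨x, hx, fun j => (hgi _ (g.get_mem j)).symm ▸ hBi _ (hxB j)⟩

lemma injOn_card_of_isChain {α : Type*} {A : Set (Finset α)} (hA : IsChain (· ⊆ ·) A) :
    Set.InjOn card A := fun _ hx _ hy hxy =>
  (hA.total hx hy).elim (fun h => eq_of_subset_of_card_le h hxy.ge)
    fun h => (eq_of_subset_of_card_le h hxy.le).symm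

end Chain

namespace Template

variable {n m : ℕ} {G : Finset (List (Fin m))} {T : Template n m}

lemma exists_isColoring_of_injective {κ : Type*} {x : κ → Finset (Fin n)}
    (hx : Function.Injective x) {i : κ → Fin m} (hi : ∀ j, i j ∈ T (x j)) :
    ∃ c, T.IsColoring c ∧ ∀ j, c (x j) = some (i j) := by
  classical
  let d : ColoredSubset (Finset (Fin n)) m := fun y =>
    if h : (T y).Nonempty then some h.choose else none
  have hd : ∀ y ∉ Set.range x, Function.extend x (some ∘ i) d y = d y := fun y hy =>
    Function.extend_apply' _ _ _ hy
  refine ⟨Function.extend x (some ∘ i) d, ⟨fun y hy => ?_, fun y hy => ?_⟩,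
    fun j => hx.extend_apply _ _ _⟩
  · by_cases hyx : y ∈ Set.range x
    · obtain ⟨j, rfl⟩ := hyx
      exact ⟨i j, hi j, hx.extend_apply _ _ _⟩
    · have hTy : (T y).Nonempty := nonempty_iff_ne_empty.2 hy
      exact ⟨hTy.choose, hTy.choose_spec, by rw [hd y hyx]; exact dif_pos hTy⟩
  · have hTy : T y = ∅ := not_not.1 hy
    rw [hd y fun ⟨j, hj⟩ => notMem_empty (i j) (hTy ▸ hj ▸ hi j)]
    exact dif_neg (by simp [hTy])

lemma IsColoring.hasColor_le_allows {c : ColoredSubset (Finset (Fin n)) m} (hc : T.IsColoring c) :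
    HasColor c ≤ Allows T := by
  intro x i hxi
  by_cases hx : x ∈ T.Supp
  · obtain ⟨j, hj, hxj⟩ := hc.1 x hx
    rwa [Option.some.inj (hxi.symm.trans hxj)]
  · cases hxi.symm.trans (hc.2 x hx)

lemma valid_iff : T.Valid G ↔ ∀ g ∈ G, ¬ Occurs (Allows T) g := by
  refine ⟨fun hT g hg ⟨x, hx, hxT⟩ => ?_, fun hT c hc g hg hgc =>
    hT g hg (Occurs.mono hc.hasColor_le_allows hgc)⟩
  obtain ⟨c, hc, hcx⟩ := exists_isColoring_of_injective hx.injective hxT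
  exact hT c hc g hg ⟨x, hx, hcx⟩

lemma omega_eq_sum_range (T : Template n m) :
    T.omega = ∑ j ∈ range m, (#{x | #(T x) = j + 1} : ℝ) * Real.log (1 + (j + 1 : ℕ)) := by
  have hmaps : ∀ x ∈ univ, #(T x) ∈ range (m + 1) := fun x _ => by
    simpa [Nat.lt_succ_iff] using card_le_univ (T x)
  have hfiber : ∀ j, ∑ x with #(T x) = j, Real.log (1 + (#(T x) : ℝ)) =
      (#{x | #(T x) = j} : ℝ) * Real.log (1 + (j : ℕ)) := fun j => by
    rw [← nsmul_eq_mul]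
    exact sum_eq_card_nsmul fun x hx => by rw [(mem_filter.1 hx).2]
  rw [omega, ← sum_fiberwise_of_maps_to hmaps, sum_congr rfl fun j _ => hfiber j, sum_range_succ']
  simp

/-- The template that agrees with `T` on `B` and assigns no colors outside of `B`. -/
def restrict (T : Template n m) (B : Finset (Finset (Fin n))) : Template n m := fun x =>
  if x ∈ B then T x else ∅

lemma allows_restrict {B : Finset (Finset (Fin n))} {x : Finset (Fin n)} {i : Fin m} :
    Allows (T.restrict B) x i ↔ x ∈ B ∧ i ∈ T x := by
  by_cases hx : x ∈ B <;> simp [Allows, restrict, hx]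

lemma supportedOn_restrict (T : Template n m) (B : Finset (Finset (Fin n))) :
    (T.restrict B).SupportedOn B := fun _ hx => if_neg hx

lemma omega_restrict (T : Template n m) (B : Finset (Finset (Fin n))) :
    (T.restrict B).omega = ∑ x ∈ B, Real.log (1 + (#(T x) : ℝ)) := by
  rw [omega, ← sum_subset (subset_univ B) fun x _ hx => by simp [restrict, hx]]
  exact sum_congr rfl fun x hx => by rw [restrict, if_pos hx]

end Template

section CriticalWeight

variable {n m : ℕ} {G : Finset (List (Fin m))}

lemma IsSparse.exists_card_support_le (hG : IsSparse G) :
    ∃ K : ℕ, ∀ (n : ℕ) (T : Template n m) (A : Set (Finset (Fin n))), T.Valid G →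
      IsChain (· ⊆ ·) A → T.SupportedOn A → #{x | (T x).Nonempty} ≤ K := by
  classical
  choose g hg hgi using hG
  refine ⟨∑ i, (g i).length, fun n T A hT hA hTA => ?_⟩
  have hcover : ({x | (T x).Nonempty} : Finset _) ⊆ univ.biUnion fun i => {x | i ∈ T x} := by
    intro x hx
    obtain ⟨i, hi⟩ := (mem_filter.1 hx).2
    exact mem_biUnion.2 ⟨i, mem_univ i, mem_filter.2 ⟨mem_univ x, hi⟩⟩
  refine (card_le_card hcover).trans (card_biUnion_le.trans (sum_le_sum fun i _ => ?_))
  refine (card_lt_length_of_not_occurs (hgi i) (Template.valid_iff.1 hT _ (hg i))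
    (hA.mono fun x hx => ?_) fun x hx => (mem_filter.1 hx).2).le
  by_contra hxA
  simp [Allows, hTA x hxA] at hx

lemma IsSparse.critWeights_finite (hG : IsSparse G) : (critWeights G).Finite := by
  obtain ⟨K, hK⟩ := hG.exists_card_support_le
  refine ((Set.finite_Iic fun _ : Fin m => K).image fun v : Fin m → ℕ =>
    ∑ j : Fin m, (v j : ℝ) * Real.log (1 + (j + 1 : ℕ))).subset ?_
  rintro w ⟨n, T, A, hT, hA, hTA, rfl⟩
  refine ⟨fun j => #{x | #(T x) = j + 1}, fun j => ?_, ?_⟩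
  · refine (card_le_card fun x hx => ?_).trans (hK n T A hT hA hTA)
    have hx : #(T x) = j + 1 := (mem_filter.1 hx).2
    exact mem_filter.2 ⟨mem_univ x, card_pos.1 (by omega)⟩
  · rw [Template.omega_eq_sum_range]
    exact Fin.sum_univ_eq_sum_range
      (fun j => (#{x | #(T x) = j + 1} : ℝ) * Real.log (1 + (j + 1 : ℕ))) m

lemma omega_restrict_mem_critWeights {T : Template n m} {B : Finset (Finset (Fin n))}
    (hB : IsChain (· ⊆ ·) (B : Set (Finset (Fin n))))
    (hT : ∀ g ∈ G, ¬ Occurs (Allows (T.restrict B)) g) : (T.restrict B).omega ∈ critWeights G :=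
  ⟨n, T.restrict B, B, Template.valid_iff.2 hT, hB, T.supportedOn_restrict B, rfl⟩

lemma zero_mem_critWeights (hnil : [] ∉ G) : 0 ∈ critWeights G := by
  have h := omega_restrict_mem_critWeights (G := G) (T := fun _ : Finset (Fin 0) => ∅) (B := ∅)
    (by simp) ?_
  · simpa [Template.omega_restrict] using h
  · rintro (_ | ⟨i, p⟩) hg hocc
    · exact hnil hg
    · obtain ⟨z, hz, -⟩ := occurs_cons.1 hocc
      simp [Template.allows_restrict] at hz

lemma isGreatest_omegaCrit (hnil : [] ∉ G) (hG : IsSparse G) :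
    IsGreatest (critWeights G) (omegaCrit G) :=
  ⟨Set.Nonempty.csSup_mem ⟨0, zero_mem_critWeights hnil⟩ hG.critWeights_finite,
    fun _ hw => le_csSup hG.critWeights_finite.bddAbove hw⟩

lemma omegaCrit_nonneg (hnil : [] ∉ G) (hG : IsSparse G) : 0 ≤ omegaCrit G :=
  (isGreatest_omegaCrit hnil hG).2 (zero_mem_critWeights hnil)

/-- A chain `B` carries weight at most `omegaCrit G` as soon as some relation `R` already contains
whatever the colors of `T` on `B` could create, because then `T` is valid on `B`. -/
lemma sum_log_le_omegaCrit (hnil : [] ∉ G) (hG : IsSparse G) {T : Template n m}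
    {R : Finset (Fin n) → Fin m → Prop} {B : Finset (Finset (Fin n))}
    (hB : IsChain (· ⊆ ·) (B : Set (Finset (Fin n))))
    (hcreate : ∀ x ∈ B, ∀ z ∈ B, x < z → ∀ i ∈ T z, ∀ g ∈ G, ∀ p, i :: p <:+ g →
      OccursAbove R p z → OccursAbove R (i :: p) x)
    (hcomplete : ∀ z ∈ B, ∀ i ∈ T z, ∀ p, i :: p ∈ G → ¬ OccursAbove R p z) :
    ∑ x ∈ B, Real.log (1 + (#(T x) : ℝ)) ≤ omegaCrit G := by
  rw [← T.omega_restrict]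
  refine (isGreatest_omegaCrit hnil hG).2 (omega_restrict_mem_critWeights hB ?_)
  rintro (_ | ⟨i, p⟩) hg hocc
  · exact hnil hg
  · obtain ⟨z, hz, hpz⟩ := occurs_cons.1 hocc
    obtain ⟨hzB, hzT⟩ := Template.allows_restrict.1 hz
    refine hcomplete z hzB i hzT p hg (hpz.transfer (B := B)
      (fun w j hw => (Template.allows_restrict.1 hw).1) (fun x hx w j q hxw hw hq => ?_)
      (List.suffix_cons i p) hzB)
    obtain ⟨hwB, hwT⟩ := Template.allows_restrict.1 hw
    exact hcreate x hx w hwB hxw j hwT _ hg q hq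

end CriticalWeight

section Numbering

variable {α : Type*} [Fintype α] {f : Numbering α} {x z : Finset α} {a b : α}

lemma isChain_isPrefix (f : Numbering α) : IsChain (· ⊆ ·) {x : Finset α | f.IsPrefix x} := by
  intro x hx y hy _
  rcases le_total #x #y with h | h
  · exact Or.inl (hx.subset_of_card_le_card hy h)
  · exact Or.inr (hy.subset_of_card_le_card hx h)

/-- The expected sum of the values of `a` on a uniformly random maximal chain of subsets, which
passes through `x` with probability `1 / (Fintype.card α).choose #x`. -/
noncomputable def lymSum (a : Finset α → ℝ) : ℝ := ∑ x, a x / (Fintype.card α).choose #x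

lemma sum_le_lymSum_mul_choose {a : Finset α → ℝ} (ha : ∀ x, 0 ≤ a x) :
    ∑ x, a x ≤ lymSum a * (Fintype.card α).choose (Fintype.card α / 2) := by
  rw [lymSum, sum_mul]
  refine sum_le_sum fun x _ => ?_
  have hpos : (0 : ℝ) < (Fintype.card α).choose #x := by
    exact_mod_cast Nat.choose_pos (card_le_univ x)
  rw [div_mul_eq_mul_div, le_div_iff₀ hpos]
  gcongr
  · exact ha x
  · exact Nat.choose_le_middle _ _

variable [DecidableEq α]

/-- The numberings in which the elements of `z` come first and `a` is the last of them. The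
corresponding maximal chains pass from `z.erase a` to `z`. -/
def prefixedEndingAt (z : Finset α) (a : α) : Finset (Numbering α) :=
  {f ∈ Numbering.prefixed z | (f a : ℕ) + 1 = #z}

lemma mem_prefixedEndingAt :
    f ∈ prefixedEndingAt z a ↔ f.IsPrefix z ∧ (f a : ℕ) + 1 = #z := by
  rw [prefixedEndingAt, mem_filter, Numbering.mem_prefixed]

lemma exists_mem_prefixedEndingAt (hf : f.IsPrefix z) (hz : z.Nonempty) :
    ∃ a ∈ z, f ∈ prefixedEndingAt z a := by
  have hpos := hz.card_pos
  have hcard : #z ≤ Fintype.card α := card_le_univ z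
  have hfa : (f (f.symm ⟨#z - 1, by omega⟩) : ℕ) + 1 = #z := by
    rw [Equiv.apply_symm_apply]
    exact Nat.sub_add_cancel hpos
  exact ⟨_, (hf _).2 (by omega), mem_prefixedEndingAt.2 ⟨hf, hfa⟩⟩

lemma subset_erase_of_mem_prefixedEndingAt (hx : f.IsPrefix x) (hxz : x < z)
    (hf : f ∈ prefixedEndingAt z a) : x ⊆ z.erase a := by
  refine subset_erase.2 ⟨hxz.le, fun ha => ?_⟩
  have hax : (f a : ℕ) < #x := (hx a).1 ha
  have haz : (f a : ℕ) + 1 = #z := (mem_prefixedEndingAt.1 hf).2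
  have hlt : #x < #z := card_lt_card hxz
  omega

lemma swap_trans_mem_prefixedEndingAt (ha : a ∈ z) (hb : b ∈ z) (hf : f ∈ prefixedEndingAt z a) :
    (Equiv.swap a b).trans f ∈ prefixedEndingAt z b := by
  obtain ⟨hfz, hfa⟩ := mem_prefixedEndingAt.1 hf
  refine mem_prefixedEndingAt.2 ⟨fun y => ?_, by simpa using hfa⟩
  rw [Equiv.trans_apply, ← hfz]
  rcases eq_or_ne y a with rfl | hya
  · simp [ha, hb]
  rcases eq_or_ne y b with rfl | hyb
  · simp [ha, hb]
  · rw [Equiv.swap_apply_of_ne_of_ne hya hyb]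

lemma card_prefixedEndingAt_le (ha : a ∈ z) (hb : b ∈ z) :
    #(prefixedEndingAt z a) ≤ #(prefixedEndingAt z b) :=
  card_le_card_of_injOn (fun f => (Equiv.swap a b).trans f)
    (fun _ hf => swap_trans_mem_prefixedEndingAt ha hb hf)
    fun _ _ _ _ h => Equiv.ext fun y => by simpa using DFunLike.congr_fun h (Equiv.swap a b y)

lemma card_mul_card_prefixedEndingAt (ha : a ∈ z) :
    #z * #(prefixedEndingAt z a) = #(Numbering.prefixed z) := by
  have hunion : Numbering.prefixed z = z.biUnion (prefixedEndingAt z) := by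
    ext f
    rw [mem_biUnion, Numbering.mem_prefixed]
    exact ⟨fun hf => exists_mem_prefixedEndingAt hf ⟨a, ha⟩,
      fun ⟨_, _, hf⟩ => (mem_prefixedEndingAt.1 hf).1⟩
  have hdisj : (z : Set α).PairwiseDisjoint (prefixedEndingAt z) := fun b _ c _ hbc =>
    disjoint_left.2 fun f hfb hfc => hbc (f.injective (Fin.ext (by
      have := (mem_prefixedEndingAt.1 hfb).2
      have := (mem_prefixedEndingAt.1 hfc).2
      omega)))
  rw [hunion, card_biUnion hdisj, ← smul_eq_mul, ← sum_const]
  exact sum_congr rfl fun b hb =>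
    (card_prefixedEndingAt_le ha hb).antisymm (card_prefixedEndingAt_le hb ha)

lemma card_prefixed_eq_div (x : Finset α) :
    (#(Numbering.prefixed x) : ℝ) =
      (Fintype.card α).factorial / (Fintype.card α).choose #x := by
  have hx : #x ≤ Fintype.card α := card_le_univ x
  have hpos : (0 : ℝ) < (Fintype.card α).choose #x := by exact_mod_cast Nat.choose_pos hx
  rw [eq_div_iff hpos.ne', Numbering.card_prefixed, ← Nat.choose_mul_factorial_mul_factorial hx]
  push_cast
  ring

lemma sum_card_prefixed_mul (a : Finset α → ℝ) :
    ∑ x, (#(Numbering.prefixed x) : ℝ) * a x = (Fintype.card α).factorial * lymSum a := by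
  rw [lymSum, mul_sum]
  exact sum_congr rfl fun x _ => by rw [card_prefixed_eq_div, div_mul_eq_mul_div, mul_div_assoc]

lemma sum_sum_isPrefix (a : Finset α → ℝ) :
    ∑ f : Numbering α, ∑ x with f.IsPrefix x, a x = (Fintype.card α).factorial * lymSum a := by
  rw [← sum_card_prefixed_mul]
  simp_rw [sum_filter]
  rw [sum_comm]
  refine sum_congr rfl fun x _ => ?_
  rw [← sum_filter, sum_const, nsmul_eq_mul]
  rfl

end Numbering

section Container

variable {α ι : Type*} [DecidableEq α] {G : Finset (List ι)} {R : Finset α → ι → Prop}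
  {T : Finset α → Finset ι} {z : Finset α} {i : ι} {p : List ι} {δ : ℝ}

open Classical in
/-- The suffixes of the members of `G`: the parts of these chains that can be found above a set. -/
noncomputable def suffixes (G : Finset (List ι)) : Finset (List ι) :=
  G.biUnion fun g => g.tails.toFinset

lemma mem_suffixes : p ∈ suffixes G ↔ ∃ g ∈ G, p <:+ g := by
  simp [suffixes]

open Classical in
/-- The elements `a` of `z` such that giving `z` the color `i` creates, above `z.erase a`, a suffix
of a member of `G` that `R` does not have there. -/
noncomputable def newBelow (G : Finset (List ι)) (R : Finset α → ι → Prop) (z : Finset α) (i : ι) :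
    Finset α :=
  {a ∈ z | ∃ p, i :: p ∈ suffixes G ∧ OccursAbove R p z ∧ ¬ OccursAbove R (i :: p) (z.erase a)}

lemma mem_newBelow {a : α} : a ∈ newBelow G R z i ↔ a ∈ z ∧ ∃ p, i :: p ∈ suffixes G ∧
    OccursAbove R p z ∧ ¬ OccursAbove R (i :: p) (z.erase a) := by
  classical
  exact mem_filter

lemma newBelow_subset : newBelow G R z i ⊆ z := fun _ ha => (mem_newBelow.1 ha).1

open Classical in
/-- The template of the colors that complete no member of `G` in `R` and create new suffixes
below at most a proportion `δ` of the elements. Taking for `R` a small part of a valid colored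
subset, it contains the colors of the rest. -/
noncomputable def container [Fintype ι] (G : Finset (List ι)) (δ : ℝ) (R : Finset α → ι → Prop)
    (x : Finset α) : Finset ι :=
  {i | (#(newBelow G R x i) : ℝ) ≤ δ * #x ∧ ∀ p, i :: p ∈ G → ¬ OccursAbove R p x}

lemma mem_container [Fintype ι] {x : Finset α} : i ∈ container G δ R x ↔
    (#(newBelow G R x i) : ℝ) ≤ δ * #x ∧ ∀ p, i :: p ∈ G → ¬ OccursAbove R p x := by
  classical
  simp [container]

lemma sum_le_mul_card_add_one {P : Type*} [Preorder P] {C D : Finset P} {w : P → ℝ} {ω : ℝ}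
    (h : ∀ B ⊆ C, (∀ x ∈ B, ∀ z ∈ B, x < z → z ∉ D) → ∑ x ∈ B, w x ≤ ω) :
    ∑ x ∈ C, w x ≤ ω * (#D + 1) := by
  classical
  let v : P → ℕ := fun x => #{z ∈ D | x < z}
  have hv : ∀ x ∈ C, v x ∈ range (#D + 1) := fun x _ =>
    mem_range.2 (Nat.lt_succ_of_le (card_filter_le _ _))
  have hv_lt : ∀ {x z}, x < z → z ∈ D → v z < v x := fun {x z} hxz hz => by
    refine card_lt_card ⟨fun y hy => ?_, fun hsub => ?_⟩
    · exact mem_filter.2 ⟨(mem_filter.1 hy).1, hxz.trans (mem_filter.1 hy).2⟩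
    · exact lt_irrefl z (mem_filter.1 (hsub (mem_filter.2 ⟨hz, hxz⟩))).2
  calc ∑ x ∈ C, w x = ∑ k ∈ range (#D + 1), ∑ x ∈ C with v x = k, w x :=
        (sum_fiberwise_of_maps_to hv _).symm
    _ ≤ ∑ _k ∈ range (#D + 1), ω := sum_le_sum fun k _ =>
        h _ (filter_subset _ _) fun x hx z hz hxz hzD =>
          ((mem_filter.1 hz).2.trans (mem_filter.1 hx).2.symm).not_lt (hv_lt hxz hzD)
    _ = ω * (#D + 1) := by rw [sum_const, card_range, nsmul_eq_mul, mul_comm, Nat.cast_succ]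

open Classical in
/-- The members of the maximal chain of `f` that have a color in `T` creating a new suffix above
the preceding member of the chain. -/
noncomputable def breakpoints [Fintype α] (G : Finset (List ι)) (R : Finset α → ι → Prop)
    (T : Finset α → Finset ι) (f : Numbering α) : Finset (Finset α) :=
  {z | ∃ i ∈ T z, ∃ a ∈ newBelow G R z i, f ∈ prefixedEndingAt z a}

lemma mem_breakpoints [Fintype α] {f : Numbering α} : z ∈ breakpoints G R T f ↔
    ∃ i ∈ T z, ∃ a ∈ newBelow G R z i, f ∈ prefixedEndingAt z a := by
  classical
  simp [breakpoints]

lemma mem_breakpoints_of_not_occursAbove [Fintype α] {f : Numbering α} {x : Finset α}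
    (hfx : f.IsPrefix x) (hfz : f.IsPrefix z) (hxz : x < z) (hi : i ∈ T z)
    (hp : i :: p ∈ suffixes G) (hpz : OccursAbove R p z) (hpx : ¬ OccursAbove R (i :: p) x) :
    z ∈ breakpoints G R T f := by
  obtain ⟨a, haz, hfa⟩ :=
    exists_mem_prefixedEndingAt hfz (card_pos.1 (pos_of_gt (card_lt_card hxz)))
  have hxa : x ≤ z.erase a := subset_erase_of_mem_prefixedEndingAt hfx hxz hfa
  exact mem_breakpoints.2
    ⟨i, hi, a, mem_newBelow.2 ⟨haz, p, hp, hpz, fun h => hpx (h.mono le_rfl hxa)⟩, hfa⟩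

lemma card_filter_mem_breakpoints_le [Fintype α]
    (hT : ∀ i ∈ T z, (#(newBelow G R z i) : ℝ) ≤ δ * #z) (hδ : 0 ≤ δ) :
    (#{f : Numbering α | z ∈ breakpoints G R T f} : ℝ) ≤
      #(T z) * (δ * #(Numbering.prefixed z)) := by
  classical
  have hcover : ({f | z ∈ breakpoints G R T f} : Finset (Numbering α)) ⊆
      (T z).biUnion fun i => (newBelow G R z i).biUnion (prefixedEndingAt z) := fun f hf => by
    simpa only [mem_biUnion] using mem_breakpoints.1 (mem_filter.1 hf).2
  have hcolor : ∀ i ∈ T z, (#((newBelow G R z i).biUnion (prefixedEndingAt z)) : ℝ) ≤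
      δ * #(Numbering.prefixed z) := fun i hi => by
    have hlast : ∀ a ∈ newBelow G R z i,
        (#(prefixedEndingAt z a) : ℝ) = #(Numbering.prefixed z) / #z := fun a ha => by
      have haz : a ∈ z := newBelow_subset ha
      have hz : (#z : ℝ) ≠ 0 := by exact_mod_cast (card_pos.2 ⟨a, haz⟩).ne'
      rw [eq_div_iff hz, mul_comm]
      exact_mod_cast card_mul_card_prefixedEndingAt haz
    calc (#((newBelow G R z i).biUnion (prefixedEndingAt z)) : ℝ)
        ≤ ∑ a ∈ newBelow G R z i, (#(prefixedEndingAt z a) : ℝ) := by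
          exact_mod_cast card_biUnion_le
      _ = #(newBelow G R z i) / #z * #(Numbering.prefixed z) := by
          rw [sum_congr rfl hlast, sum_const, nsmul_eq_mul, ← mul_div_assoc, div_mul_eq_mul_div]
      _ ≤ δ * #(Numbering.prefixed z) := by
          gcongr
          exact div_le_of_le_mul₀ (Nat.cast_nonneg _) hδ (hT i hi)
  calc (#{f : Numbering α | z ∈ breakpoints G R T f} : ℝ)
      ≤ ∑ i ∈ T z, (#((newBelow G R z i).biUnion (prefixedEndingAt z)) : ℝ) := by
        exact_mod_cast (card_le_card hcover).trans card_biUnion_le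
    _ ≤ #(T z) * (δ * #(Numbering.prefixed z)) := by
        rw [← nsmul_eq_mul]
        exact sum_le_card_nsmul _ _ _ hcolor

lemma sum_card_breakpoints_le [Fintype α]
    (hT : ∀ z, ∀ i ∈ T z, (#(newBelow G R z i) : ℝ) ≤ δ * #z) (hδ : 0 ≤ δ) :
    ∑ f : Numbering α, (#(breakpoints G R T f) : ℝ) ≤
      (Fintype.card α).factorial * (δ * lymSum fun z => (#(T z) : ℝ)) := by
  classical
  calc ∑ f : Numbering α, (#(breakpoints G R T f) : ℝ)
      = ∑ z, (#{f : Numbering α | z ∈ breakpoints G R T f} : ℝ) := by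
        simpa [bipartiteAbove, bipartiteBelow] using congrArg (Nat.cast (R := ℝ))
          (sum_card_bipartiteAbove_eq_sum_card_bipartiteBelow (s := univ) (t := univ)
            fun f z => z ∈ breakpoints G R T f)
    _ ≤ ∑ z, #(T z) * (δ * #(Numbering.prefixed z)) :=
        sum_le_sum fun z _ => card_filter_mem_breakpoints_le (hT z) hδ
    _ = (Fintype.card α).factorial * (δ * lymSum fun z => (#(T z) : ℝ)) := by
        rw [mul_left_comm, ← sum_card_prefixed_mul, mul_sum]
        exact sum_congr rfl fun z _ => by ring

end Container

section ContainerWeight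

variable {n m : ℕ} {G : Finset (List (Fin m))}

lemma natCast_le_mul_log {k N : ℕ} (hk : k ≤ N) :
    (k : ℝ) ≤ N / Real.log 2 * Real.log (1 + k) := by
  rcases k.eq_zero_or_pos with rfl | hpos
  · simp
  have hlog : Real.log 2 ≤ Real.log (1 + k) := by
    have : (1 : ℝ) ≤ k := by exact_mod_cast hpos
    exact Real.log_le_log two_pos (by linarith)
  have hlog2 : 0 < Real.log 2 := Real.log_pos one_lt_two
  rw [div_mul_eq_mul_div, le_div_iff₀ hlog2]
  gcongr

lemma lymSum_card_le {α ι : Type*} [Fintype α] [Fintype ι] (T : Finset α → Finset ι) :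
    lymSum (fun z => (#(T z) : ℝ)) ≤
      Fintype.card ι / Real.log 2 * lymSum fun z => Real.log (1 + (#(T z) : ℝ)) := by
  rw [lymSum, lymSum, mul_sum]
  refine sum_le_sum fun z _ => ?_
  rw [← mul_div_assoc]
  gcongr
  exact natCast_le_mul_log (card_le_univ (T z))

lemma sum_log_container_isPrefix_le (hnil : [] ∉ G) (hG : IsSparse G) (δ : ℝ)
    (R : Finset (Fin n) → Fin m → Prop) (f : Numbering (Fin n)) :
    ∑ x with f.IsPrefix x, Real.log (1 + (#(container G δ R x) : ℝ)) ≤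
      omegaCrit G * (#(breakpoints G R (container G δ R) f) + 1) := by
  refine sum_le_mul_card_add_one fun B hB hBD => sum_log_le_omegaCrit (R := R) hnil hG
    ((isChain_isPrefix f).mono fun x hx => (mem_filter.1 (hB hx)).2)
    (fun x hx z hz hxz i hi g hg p hp hpz => ?_) fun z _ i hi => (mem_container.1 hi).2
  by_contra hpx
  exact hBD x hx z hz hxz (mem_breakpoints_of_not_occursAbove (mem_filter.1 (hB hx)).2
    (mem_filter.1 (hB hz)).2 hxz hi (mem_suffixes.2 ⟨g, hg, hp⟩) hpz hpx)

lemma lymSum_log_container_le (hnil : [] ∉ G) (hG : IsSparse G) {δ : ℝ} (hδ : 0 ≤ δ)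
    (R : Finset (Fin n) → Fin m → Prop) :
    lymSum (fun x => Real.log (1 + (#(container G δ R x) : ℝ))) ≤ omegaCrit G * (δ *
      (m / Real.log 2 * lymSum fun x => Real.log (1 + (#(container G δ R x) : ℝ))) + 1) := by
  have hω := omegaCrit_nonneg hnil hG
  have hfact : (0 : ℝ) < (Fintype.card (Fin n)).factorial := by
    exact_mod_cast Nat.factorial_pos _
  have hbreak := sum_card_breakpoints_le
    (fun z i (hi : i ∈ container G δ R z) => (mem_container.1 hi).1) hδ
  have hcard := lymSum_card_le (container G δ R)
  rw [Fintype.card_fin] at hcard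
  refine le_of_mul_le_mul_left ?_ hfact
  rw [← sum_sum_isPrefix]
  calc ∑ f : Numbering (Fin n), ∑ x with f.IsPrefix x, Real.log (1 + (#(container G δ R x) : ℝ))
      ≤ ∑ f : Numbering (Fin n), omegaCrit G * (#(breakpoints G R (container G δ R) f) + 1) :=
        sum_le_sum fun f _ => sum_log_container_isPrefix_le hnil hG δ R f
    _ = omegaCrit G *
        (∑ f : Numbering (Fin n), (#(breakpoints G R (container G δ R) f) : ℝ) +
          (Fintype.card (Fin n)).factorial) := by
        rw [← mul_sum, sum_add_distrib, sum_const, card_univ, Fintype.card_numbering, nsmul_one]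
    _ ≤ omegaCrit G * ((Fintype.card (Fin n)).factorial * (δ *
        (m / Real.log 2 * lymSum fun x => Real.log (1 + (#(container G δ R x) : ℝ)))) +
          (Fintype.card (Fin n)).factorial) := by
        gcongr
        exact hbreak.trans (by gcongr)
    _ = _ := by ring

lemma exists_forall_omega_container_le (hnil : [] ∉ G) (hG : IsSparse G) {η : ℝ} (hη : 0 < η) :
    ∃ δ > 0, ∀ (n : ℕ) (R : Finset (Fin n) → Fin m → Prop),
      Template.omega (container G δ R) ≤ (omegaCrit G + η) * n.choose (n / 2) := by
  set ω := omegaCrit G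
  have hω : 0 ≤ ω := omegaCrit_nonneg hnil hG
  set κ := ω * (m / Real.log 2) with hκ
  have : 0 ≤ κ := mul_nonneg hω (div_nonneg m.cast_nonneg (Real.log_nonneg one_le_two))
  set δ := η / (κ * (ω + η) + 1)
  have hδ : 0 < δ := by positivity
  have hδη : κ * δ * (ω + η) + δ = η := by
    have : δ * (κ * (ω + η) + 1) = η := div_mul_cancel₀ η (by positivity)
    linarith
  refine ⟨δ, hδ, fun n R => ?_⟩
  set a := fun x => Real.log (1 + (#(container G δ R x) : ℝ))
  have ha : ∀ x, 0 ≤ a x := fun x => Real.log_nonneg (by simp)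
  have hsmall : 0 < 1 - κ * δ := pos_of_mul_pos_left (b := ω + η) (by linarith) (by positivity)
  have hlym : lymSum a ≤ ω + η := by
    refine le_of_mul_le_mul_right ?_ hsmall
    have h : lymSum a ≤ ω * (δ * (m / Real.log 2 * lymSum a) + 1) :=
      lymSum_log_container_le hnil hG hδ.le R
    rw [hκ] at hδη ⊢
    linarith
  calc Template.omega (container G δ R) = ∑ x, a x := rfl
    _ ≤ lymSum a * n.choose (n / 2) := by
      simpa only [Fintype.card_fin] using sum_le_lymSum_mul_choose ha
    _ ≤ (ω + η) * n.choose (n / 2) := by gcongr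

end ContainerWeight

section Potential

variable {α ι : Type*} {G : Finset (List ι)} {R R' : Finset α → ι → Prop} {x y : Finset α} {i : ι}
  {p : List ι} {δ : ℝ}

open Classical in
/-- The suffixes of members of `G` that occur in `R` above `y`. -/
noncomputable def reached (G : Finset (List ι)) (R : Finset α → ι → Prop) (y : Finset α) :
    Finset (List ι) :=
  {p ∈ suffixes G | OccursAbove R p y}

lemma mem_reached : p ∈ reached G R y ↔ p ∈ suffixes G ∧ OccursAbove R p y := by
  classical
  exact mem_filter

lemma reached_subset_suffixes : reached G R y ⊆ suffixes G := fun _ hp => (mem_reached.1 hp).1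

lemma reached_mono (hR : R ≤ R') (y : Finset α) : reached G R y ⊆ reached G R' y := fun _ hp =>
  mem_reached.2 ⟨(mem_reached.1 hp).1, (mem_reached.1 hp).2.mono hR le_rfl⟩

section DecidableEq

variable [DecidableEq α]

lemma card_reached_erase_add_one_le (hR : R ≤ R') (hx : R' x i) {a : α}
    (ha : a ∈ newBelow G R x i) :
    #(reached G R (x.erase a)) + 1 ≤ #(reached G R' (x.erase a)) := by
  obtain ⟨hax, p, hp, hpx, hpa⟩ := mem_newBelow.1 ha
  have hpa' : OccursAbove R' (i :: p) (x.erase a) :=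
    occursAbove_cons.2 ⟨x, erase_ssubset hax, hx, hpx.mono hR le_rfl⟩
  exact card_lt_card (ssubset_iff_of_subset (reached_mono hR _) |>.2
    ⟨i :: p, mem_reached.2 ⟨hp, hpa'⟩, fun h => hpa (mem_reached.1 h).2⟩)

lemma newBelow_eq_empty (hx : R x i) : newBelow G R x i = ∅ := by
  refine eq_empty_of_forall_notMem fun a ha => ?_
  obtain ⟨hax, p, -, hpx, hpa⟩ := mem_newBelow.1 ha
  exact hpa (occursAbove_cons.2 ⟨x, erase_ssubset hax, hx, hpx⟩)

end DecidableEq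

variable [Fintype α]

/-- The number of pairs of a set `y` and a suffix that occurs above `y`, weighted so that a color
at `x` that is not in the container raises it by at least `δ`. -/
noncomputable def potential (G : Finset (List ι)) (R : Finset α → ι → Prop) : ℝ :=
  ∑ y, (#(reached G R y) : ℝ) / (#y + 1)

lemma potential_nonneg : 0 ≤ potential G R := sum_nonneg fun _ _ => by positivity

lemma potential_add_le [DecidableEq α] (hR : R ≤ R') (hx : R' x i) :
    potential G R + #(newBelow G R x i) / #x ≤ potential G R' := by
  let gain : Finset α → ℝ := fun y => (#(reached G R' y) - #(reached G R y)) / (#y + 1)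
  have hgain : ∀ y, 0 ≤ gain y := fun y =>
    div_nonneg (sub_nonneg.2 (by exact_mod_cast card_le_card (reached_mono hR y))) (by positivity)
  have hinj : Set.InjOn x.erase (newBelow G R x i) :=
    (erase_injOn x).mono newBelow_subset
  have hterm : ∀ a ∈ newBelow G R x i, 1 / (#x : ℝ) ≤ gain (x.erase a) := fun a ha => by
    have hcard : (#(x.erase a) : ℝ) + 1 = #x := by
      exact_mod_cast card_erase_add_one (newBelow_subset ha)
    have hreached : (#(reached G R (x.erase a)) : ℝ) + 1 ≤ #(reached G R' (x.erase a)) := by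
      exact_mod_cast card_reached_erase_add_one_le hR hx ha
    rw [← hcard]
    unfold gain
    gcongr
    linarith
  rw [← le_sub_iff_add_le']
  calc (#(newBelow G R x i) : ℝ) / #x = ∑ _a ∈ newBelow G R x i, 1 / (#x : ℝ) := by
        rw [sum_const, nsmul_eq_mul, mul_one_div]
    _ ≤ ∑ y ∈ (newBelow G R x i).image x.erase, gain y := by
        rw [sum_image hinj]
        exact sum_le_sum hterm
    _ ≤ ∑ y, gain y := sum_le_univ_sum_of_nonneg hgain
    _ = potential G R' - potential G R := by
        rw [potential, potential, ← sum_sub_distrib]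
        exact sum_congr rfl fun y _ => sub_div _ _ _

lemma sum_one_div_card_add_one_le :
    ∑ y : Finset α, (1 : ℝ) / (#y + 1) ≤ 2 ^ (Fintype.card α + 1) / (Fintype.card α + 1) := by
  set n := Fintype.card α with hn
  have hterm : ∀ k ∈ range (n + 1),
      n.choose k • ((1 : ℝ) / (k + 1)) = ((n + 1).choose (k + 1) : ℝ) / (n + 1) := fun k _ => by
    have h : ((n : ℝ) + 1) * n.choose k = (n + 1).choose (k + 1) * (k + 1) := by
      exact_mod_cast Nat.add_one_mul_choose_eq n k
    rw [nsmul_eq_mul, mul_one_div, div_eq_div_iff (by positivity) (by positivity), ← h, mul_comm]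
  have hchoose : ∑ k ∈ range (n + 1), (n + 1).choose (k + 1) ≤ 2 ^ (n + 1) := by
    have h := Nat.sum_range_choose (n + 1)
    rw [sum_range_succ'] at h
    omega
  rw [← powerset_univ, sum_powerset_apply_card fun k => (1 : ℝ) / (k + 1), card_univ, ← hn,
    sum_congr rfl hterm, ← sum_div]
  gcongr
  exact_mod_cast hchoose

lemma potential_le :
    potential G R ≤
      #(suffixes G) * (2 ^ (Fintype.card α + 1) / (Fintype.card α + 1)) := by
  calc potential G R ≤ ∑ y : Finset α, #(suffixes G) * ((1 : ℝ) / (#y + 1)) :=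
        sum_le_sum fun y _ => by
          rw [mul_one_div]
          gcongr
          exact reached_subset_suffixes
    _ ≤ #(suffixes G) * (2 ^ (Fintype.card α + 1) / (Fintype.card α + 1)) := by
        rw [← mul_sum]
        gcongr
        exact sum_one_div_card_add_one_le

end Potential

section Fingerprint

/-- The underlying set of a colored subset. -/
def coloredSupport {P ι : Type*} [Fintype P] (c : P → Option ι) : Finset P := {x | (c x).isSome}

/-- Take a largest set `S` such that the restriction `F` of `c` to `S` has potential at least
`δ * #S`: a color of `c` outside of the container would allow `S` to be enlarged. -/
lemma exists_fingerprint {α ι : Type*} [Fintype α] [DecidableEq α] [Fintype ι]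
    {G : Finset (List ι)} {c : Finset α → Option ι} (hc : ∀ g ∈ G, ¬ Occurs (HasColor c) g)
    {δ : ℝ} (hδ : 0 ≤ δ) : ∃ F : Finset α → Option ι,
      δ * #(coloredSupport F) ≤ potential G (HasColor F) ∧
      ∀ x i, c x = some i → i ∈ container G δ (HasColor F) x := by
  let F : Finset (Finset α) → Finset α → Option ι := fun S x => if x ∈ S then c x else none
  have hF : ∀ {S x i}, HasColor (F S) x i ↔ x ∈ S ∧ c x = some i := fun {S x i} => by
    simp [HasColor, F]
  have hsupp : ∀ S, coloredSupport (F S) ⊆ S := fun S x hx => by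
    obtain ⟨i, hi⟩ := Option.isSome_iff_exists.1 (mem_filter.1 hx).2
    exact (hF.1 hi).1
  obtain ⟨S, hS, hmax⟩ := exists_max_image
    ({S | δ * #S ≤ potential G (HasColor (F S))} : Finset (Finset (Finset α))) card
    ⟨∅, mem_filter.2 ⟨mem_univ _, by simpa using potential_nonneg⟩⟩
  have hSpot : δ * #S ≤ potential G (HasColor (F S)) := (mem_filter.1 hS).2
  have hSc : HasColor (F S) ≤ HasColor c := fun _ _ h => (hF.1 h).2
  have hSδ : δ * #(coloredSupport (F S)) ≤ δ * #S := by
    gcongr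
    exact hsupp S
  refine ⟨F S, hSδ.trans hSpot, fun x i hxi => mem_container.2 ⟨?_, fun p hp h => hc _ hp
    (occurs_cons.2 ⟨x, hxi, h.mono hSc le_rfl⟩)⟩⟩
  by_contra! hnew
  have hxS : x ∉ S := fun hxS => hnew.not_ge (by
    rw [newBelow_eq_empty (hF.2 ⟨hxS, hxi⟩), card_empty, Nat.cast_zero]
    positivity)
  have hxpos : (0 : ℝ) < #x := calc
    0 ≤ δ * #x := by positivity
    _ < #(newBelow G (HasColor (F S)) x i) := hnew
    _ ≤ #x := Nat.cast_le.2 (card_le_card newBelow_subset)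
  have hgain := potential_add_le (G := G) (R := HasColor (F S)) (R' := HasColor (F (insert x S)))
    (fun y j hy => hF.2 ⟨mem_insert_of_mem (hF.1 hy).1, (hF.1 hy).2⟩)
    (hF.2 ⟨mem_insert_self x S, hxi⟩)
  have hinsert : δ * #(insert x S) ≤ potential G (HasColor (F (insert x S))) := by
    rw [card_insert_of_notMem hxS, Nat.cast_succ, mul_add_one]
    exact (add_le_add hSpot ((le_div_iff₀ hxpos).2 hnew.le)).trans hgain
  have hle := hmax _ (mem_filter.2 ⟨mem_univ _, hinsert⟩)
  rw [card_insert_of_notMem hxS] at hle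
  omega

lemma sum_pow_card_coloredSupport {P ι A : Type*} [Fintype P] [DecidableEq P] [Fintype ι]
    [CommSemiring A] (t : A) :
    ∑ F : P → Option ι, t ^ #(coloredSupport F) = (1 + Fintype.card ι * t) ^ Fintype.card P := by
  have hprod : ∀ F : P → Option ι,
      t ^ #(coloredSupport F) = ∏ x, if (F x).isSome then t else 1 := fun F => by
    rw [← prod_filter, prod_const, coloredSupport]
  rw [sum_congr rfl fun F _ => hprod F,
    ← Fintype.prod_sum fun (_ : P) (o : Option ι) => if o.isSome then t else 1]
  simp [Fintype.sum_option]

lemma card_filter_card_coloredSupport_le {P ι : Type*} [Fintype P] [DecidableEq P] [Fintype ι]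
    (N : ℝ) {L : ℝ} (hL : 0 ≤ L) :
    (#{F : P → Option ι | (#(coloredSupport F) : ℝ) ≤ N} : ℝ) ≤
      Real.exp (N * L + Fintype.card ι * Fintype.card P * Real.exp (-L)) := by
  have hterm : ∀ F : P → Option ι, (#(coloredSupport F) : ℝ) ≤ N →
      1 ≤ Real.exp (N * L) * Real.exp (-L) ^ #(coloredSupport F) := fun F hF => by
    rw [← Real.exp_nat_mul, ← Real.exp_add, Real.one_le_exp_iff]
    nlinarith
  calc (#{F : P → Option ι | (#(coloredSupport F) : ℝ) ≤ N} : ℝ)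
      ≤ ∑ F : P → Option ι with (#(coloredSupport F) : ℝ) ≤ N,
          Real.exp (N * L) * Real.exp (-L) ^ #(coloredSupport F) := by
        rw [← nsmul_one]
        exact card_nsmul_le_sum _ _ _ fun F hF => hterm F (mem_filter.1 hF).2
    _ ≤ ∑ F : P → Option ι, Real.exp (N * L) * Real.exp (-L) ^ #(coloredSupport F) :=
        sum_le_univ_sum_of_nonneg fun _ => by positivity
    _ = Real.exp (N * L) * (1 + Fintype.card ι * Real.exp (-L)) ^ Fintype.card P := by
        rw [← mul_sum, sum_pow_card_coloredSupport]
    _ ≤ Real.exp (N * L) * Real.exp (Fintype.card ι * Real.exp (-L)) ^ Fintype.card P := by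
        gcongr
        rw [add_comm]
        exact Real.add_one_le_exp _
    _ = Real.exp (N * L + Fintype.card ι * Fintype.card P * Real.exp (-L)) := by
        rw [← Real.exp_nat_mul, ← Real.exp_add]
        ring_nf

variable {n m : ℕ} {G : Finset (List (Fin m))}

lemma card_piFinset_insertNone (T : Template n m) :
    (#(Fintype.piFinset fun x => insertNone (T x)) : ℝ) = Real.exp T.omega := by
  rw [Fintype.card_piFinset, Template.omega, Real.exp_sum, Nat.cast_prod]
  refine prod_congr rfl fun x _ => ?_
  rw [Real.exp_log (by positivity), card_insertNone, Nat.cast_succ, add_comm]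

lemma ncard_Lam_le {δ W : ℝ} (hδ : 0 < δ) (hn : 1 ≤ n)
    (hW : ∀ R : Finset (Fin n) → Fin m → Prop, Template.omega (container G δ R) ≤ W) :
    ((Lam G n).ncard : ℝ) ≤ Real.exp
      (#(suffixes G) * (2 ^ (n + 1) / (n + 1)) / δ * Real.log n + m * 2 ^ n / n + W) := by
  classical
  set N : ℝ := #(suffixes G) * (2 ^ (n + 1) / (n + 1)) / δ with hN
  set small : Finset (ColoredSubset (Finset (Fin n)) m) := {F | (#(coloredSupport F) : ℝ) ≤ N}
  set below : ColoredSubset (Finset (Fin n)) m → Finset (ColoredSubset (Finset (Fin n)) m) :=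
    fun F => Fintype.piFinset fun x => insertNone (container G δ (HasColor F) x)
  have hcover : Lam G n ⊆ small.biUnion below := fun c hc => by
    obtain ⟨F, hF, hFc⟩ := exists_fingerprint hc hδ.le
    have hFN : (#(coloredSupport F) : ℝ) ≤ N := by
      rw [hN, le_div_iff₀' hδ]
      simpa only [Fintype.card_fin] using hF.trans potential_le
    exact mem_coe.2 (mem_biUnion.2 ⟨F, mem_filter.2 ⟨mem_univ F, hFN⟩,
      Fintype.mem_piFinset.2 fun x => mem_insertNone.2 fun i => hFc x i⟩)
  have hsmall : (#small : ℝ) ≤ Real.exp (N * Real.log n + m * 2 ^ n / n) := by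
    have hn0 : (0 : ℝ) < n := by exact_mod_cast hn
    have h := card_filter_card_coloredSupport_le (P := Finset (Fin n)) (ι := Fin m) N
      (Real.log_nonneg (Nat.one_le_cast.2 hn))
    simpa [Real.exp_neg, Real.exp_log hn0, ← div_eq_mul_inv] using h
  calc ((Lam G n).ncard : ℝ) ≤ #(small.biUnion below) := by
        rw [← Set.ncard_coe_finset]
        exact_mod_cast Set.ncard_le_ncard hcover (finite_toSet _)
    _ ≤ ∑ F ∈ small, (#(below F) : ℝ) := by exact_mod_cast card_biUnion_le
    _ ≤ #small * Real.exp W := by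
        rw [← nsmul_eq_mul]
        refine sum_le_card_nsmul _ _ _ fun F _ => ?_
        rw [card_piFinset_insertNone]
        exact Real.exp_le_exp.2 (hW _)
    _ ≤ Real.exp (N * Real.log n + m * 2 ^ n / n + W) := by
        rw [Real.exp_add]
        gcongr

end Fingerprint

section Spread

variable {r m : ℕ} {G : Finset (List (Fin m))} {T : Template r m} {A : Set (Finset (Fin r))}

/-- The template on `n` points that allows the colors of `T` on the sets of size `k` on all sets of
size `n / 2 + k`. -/
def spread (T : Template r m) (n : ℕ) : Template n m := fun y =>
  {i | ∃ x, #x + n / 2 = #y ∧ i ∈ T x}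

lemma mem_spread {n : ℕ} {y : Finset (Fin n)} {i : Fin m} :
    i ∈ spread T n y ↔ ∃ x, #x + n / 2 = #y ∧ i ∈ T x := by
  simp [spread]

lemma Template.SupportedOn.mem_of_mem (hTA : T.SupportedOn A) {x : Finset (Fin r)} {i : Fin m}
    (hi : i ∈ T x) : x ∈ A := by
  by_contra hx
  rw [hTA x hx] at hi
  exact notMem_empty i hi

lemma sum_log_level_le (hA : IsChain (· ⊆ ·) A) (hTA : T.SupportedOn A) {n : ℕ}
    (y : Finset (Fin n)) :
    ∑ x with #x + n / 2 = #y, Real.log (1 + (#(T x) : ℝ)) ≤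
      Real.log (1 + (#(spread T n y) : ℝ)) := by
  rcases (spread T n y).eq_empty_or_nonempty with hempty | ⟨i, hi⟩
  · refine (sum_eq_zero fun x hx => ?_).trans_le (Real.log_nonneg (by simp))
    have hTx : T x = ∅ := eq_empty_of_forall_notMem fun i hi =>
      notMem_empty i (hempty ▸ mem_spread.2 ⟨x, (mem_filter.1 hx).2, hi⟩)
    simp [hTx]
  · obtain ⟨x, hx, hxi⟩ := mem_spread.1 hi
    rw [sum_eq_single_of_mem x (mem_filter.2 ⟨mem_univ x, hx⟩) fun x' hx' hne => ?_]
    · gcongr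
      exact fun j hj => mem_spread.2 ⟨x, hx, hj⟩
    · have hcard : #x' = #x := by
        have := (mem_filter.1 hx').2
        omega
      have hTx' : T x' = ∅ := eq_empty_of_forall_notMem fun j hj =>
        hne (injOn_card_of_isChain hA (hTA.mem_of_mem hj) (hTA.mem_of_mem hxi) hcard)
      simp [hTx']

lemma sum_log_mul_choose_le_omega_spread (hA : IsChain (· ⊆ ·) A) (hTA : T.SupportedOn A) (n : ℕ) :
    ∑ x, Real.log (1 + (#(T x) : ℝ)) * n.choose (n / 2 + #x) ≤ (spread T n).omega := by
  have hcard : ∀ x : Finset (Fin r), n.choose (n / 2 + #x) =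
      #{y : Finset (Fin n) | #x + n / 2 = #y} := fun x => by
    simp_rw [eq_comm (a := #x + n / 2), univ_filter_card_eq, card_powersetCard, card_univ,
      Fintype.card_fin, add_comm]
  calc ∑ x, Real.log (1 + (#(T x) : ℝ)) * n.choose (n / 2 + #x)
      = ∑ x, ∑ y : Finset (Fin n) with #x + n / 2 = #y, Real.log (1 + (#(T x) : ℝ)) :=
        sum_congr rfl fun x _ => by rw [hcard, sum_const, nsmul_eq_mul, mul_comm]
    _ = ∑ y : Finset (Fin n), ∑ x with #x + n / 2 = #y, Real.log (1 + (#(T x) : ℝ)) := by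
        simp_rw [sum_filter]
        exact sum_comm
    _ ≤ (spread T n).omega := sum_le_sum fun y _ => sum_log_level_le hA hTA y

lemma Template.Valid.not_occurs_spread (hT : T.Valid G) (hA : IsChain (· ⊆ ·) A)
    (hTA : T.SupportedOn A) (n : ℕ) : ∀ g ∈ G, ¬ Occurs (Allows (spread T n)) g := by
  rintro g hg ⟨y, hy, hyT⟩
  choose x hxy hxT using fun j => mem_spread.1 (hyT j)
  refine Template.valid_iff.1 hT g hg ⟨x, fun a b hab => ?_, hxT⟩
  refine hA.lt_of_not_ge (hTA.mem_of_mem (hxT b)) (hTA.mem_of_mem (hxT a)) fun hba => ?_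
  have hcard := card_le_card hba
  have := card_lt_card (hy hab)
  have := hxy a
  have := hxy b
  omega

lemma exp_omega_le_ncard_Lam {n : ℕ} {T : Template n m} (hT : ∀ g ∈ G, ¬ Occurs (Allows T) g) :
    Real.exp T.omega ≤ (Lam G n).ncard := by
  rw [← card_piFinset_insertNone, ← Set.ncard_coe_finset]
  refine Nat.cast_le.2 (Set.ncard_le_ncard (fun c hc g hg hgc => hT g hg ?_) (Set.toFinite _))
  exact Occurs.mono (R := HasColor c)
    (fun x i hi => mem_insertNone.1 (Fintype.mem_piFinset.1 hc x) i hi) hgc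

end Spread

section MiddleBinomial

open Filter Topology

lemma sixteen_pow_le_mul_centralBinom_sq (k : ℕ) : 16 ^ k ≤ (4 * k + 1) * k.centralBinom ^ 2 := by
  induction k with
  | zero => simp
  | succ k ih =>
    refine le_of_mul_le_mul_left (a := (k + 1) ^ 2) ?_ (by positivity)
    calc (k + 1) ^ 2 * 16 ^ (k + 1) = 16 * (k + 1) ^ 2 * 16 ^ k := by ring
      _ ≤ 16 * (k + 1) ^ 2 * ((4 * k + 1) * k.centralBinom ^ 2) := by gcongr
      _ = 4 * (4 * (4 * k + 1) * (k + 1) ^ 2) * k.centralBinom ^ 2 := by ring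
      _ ≤ 4 * ((4 * k + 5) * (2 * k + 1) ^ 2) * k.centralBinom ^ 2 := by
        gcongr 4 * ?_ * _
        nlinarith
      _ = (4 * (k + 1) + 1) * (2 * (2 * k + 1) * k.centralBinom) ^ 2 := by ring
      _ = (k + 1) ^ 2 * ((4 * (k + 1) + 1) * (k + 1).centralBinom ^ 2) := by
        rw [← Nat.succ_mul_centralBinom_succ]
        ring

lemma four_pow_le_mul_choose_half_sq (n : ℕ) :
    4 ^ n ≤ 4 * (2 * n + 1) * n.choose (n / 2) ^ 2 := by
  have hcentral : (n / 2).centralBinom ≤ n.choose (n / 2) := Nat.choose_le_choose _ (by omega)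
  have hhalf : 4 * (n / 2) + 1 ≤ 2 * n + 1 := by omega
  calc 4 ^ n ≤ 4 ^ (2 * (n / 2) + 1) := Nat.pow_le_pow_right (by norm_num) (by omega)
    _ = 4 * 16 ^ (n / 2) := by rw [pow_succ, pow_mul, mul_comm]; norm_num
    _ ≤ 4 * ((4 * (n / 2) + 1) * (n / 2).centralBinom ^ 2) := by
      gcongr
      exact sixteen_pow_le_mul_centralBinom_sq _
    _ ≤ 4 * ((2 * n + 1) * n.choose (n / 2) ^ 2) := by gcongr
    _ = 4 * (2 * n + 1) * n.choose (n / 2) ^ 2 := (mul_assoc _ _ _).symm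

lemma two_pow_div_le_mul_choose_half (n : ℕ) :
    (2 : ℝ) ^ n / n ≤ 4 / √n * n.choose (n / 2) := by
  rcases n.eq_zero_or_pos with rfl | hn
  · simp
  have hn1 : (1 : ℝ) ≤ n := by exact_mod_cast hn
  have : 0 < √(n : ℝ) := Real.sqrt_pos.2 (by linarith)
  have hpow : (2 : ℝ) ^ n ≤ 4 * √n * n.choose (n / 2) := by
    refine le_of_sq_le_sq ?_ (by positivity)
    calc ((2 : ℝ) ^ n) ^ 2 = 4 ^ n := by rw [← pow_mul, mul_comm, pow_mul]; norm_num
      _ ≤ 4 * (2 * n + 1) * (n.choose (n / 2) : ℝ) ^ 2 := by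
        exact_mod_cast four_pow_le_mul_choose_half_sq n
      _ ≤ 16 * n * (n.choose (n / 2) : ℝ) ^ 2 :=
        mul_le_mul_of_nonneg_right (by linarith) (sq_nonneg _)
      _ = (4 * √n * n.choose (n / 2)) ^ 2 := by
        rw [mul_pow, mul_pow, Real.sq_sqrt n.cast_nonneg]
        ring
  calc (2 : ℝ) ^ n / n ≤ 4 * √n * n.choose (n / 2) / (√n * √n) := by
        rw [Real.mul_self_sqrt n.cast_nonneg]
        gcongr
    _ = 4 / √n * n.choose (n / 2) := by field_simp

lemma choose_half_pos (n : ℕ) : (0 : ℝ) < n.choose (n / 2) := by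
  exact_mod_cast Nat.choose_pos (Nat.div_le_self n 2)

lemma tendsto_sub_half_add_div (k : ℕ) :
    Tendsto (fun n : ℕ => ((n - (n / 2 + k) : ℕ) : ℝ) / ((n / 2 : ℕ) + k + 1)) atTop (𝓝 1) := by
  have hlow : Tendsto (fun n : ℕ => 1 - (2 * k + 1 : ℝ) / ((n / 2 : ℕ) + k + 1)) atTop (𝓝 1) := by
    have hhalf : Tendsto (fun n : ℕ => ((n / 2 : ℕ) : ℝ) + k + 1) atTop atTop :=
      tendsto_atTop_add_const_right _ _ (tendsto_atTop_add_const_right _ _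
        (tendsto_natCast_atTop_atTop.comp (Nat.tendsto_div_const_atTop two_ne_zero)))
    simpa using (hhalf.const_div_atTop (2 * k + 1 : ℝ)).const_sub 1
  refine tendsto_of_tendsto_of_tendsto_of_le_of_le hlow tendsto_const_nhds (fun n => ?_) fun n => ?_
  · have h : ((n / 2 : ℕ) : ℝ) ≤ ((n - (n / 2 + k) : ℕ) : ℝ) + k := by
      exact_mod_cast (by omega : n / 2 ≤ n - (n / 2 + k) + k)
    have hpos : (0 : ℝ) < (n / 2 : ℕ) + k + 1 := by positivity
    rw [sub_le_iff_le_add, ← add_div, le_div_iff₀ hpos]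
    linarith
  · have h : ((n - (n / 2 + k) : ℕ) : ℝ) ≤ (n / 2 : ℕ) + k + 1 := by
      exact_mod_cast (by omega : n - (n / 2 + k) ≤ n / 2 + k + 1)
    exact div_le_one_of_le₀ h (by positivity)

lemma tendsto_choose_half_add_div (k : ℕ) :
    Tendsto (fun n : ℕ => (n.choose (n / 2 + k) : ℝ) / n.choose (n / 2)) atTop (𝓝 1) := by
  induction k with
  | zero =>
    exact tendsto_const_nhds.congr fun n => by rw [add_zero, div_self (choose_half_pos n).ne']
  | succ k ih =>
    refine (mul_one (1 : ℝ) ▸ ih.mul (tendsto_sub_half_add_div k)).congr fun n => ?_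
    have hpos : (0 : ℝ) < (n / 2 : ℕ) + k + 1 := by positivity
    have hstep : (n.choose (n / 2 + (k + 1)) : ℝ) * ((n / 2 : ℕ) + k + 1) =
        n.choose (n / 2 + k) * ((n - (n / 2 + k) : ℕ) : ℝ) := by
      exact_mod_cast Nat.choose_succ_right_eq n (n / 2 + k)
    rw [div_mul_div_comm, ← hstep, mul_div_mul_right _ _ hpos.ne']

end MiddleBinomial

section Asymptotics

open Filter Topology

variable {m n : ℕ} {G : Finset (List (Fin m))}

lemma none_mem_Lam (hnil : [] ∉ G) : (fun _ => none) ∈ Lam G n := by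
  rintro (_ | ⟨i, p⟩) hg ⟨x, -, hx⟩
  · exact hnil hg
  · cases hx ⟨0, by simp⟩

lemma ncard_Lam_pos (hnil : [] ∉ G) (n : ℕ) : (0 : ℝ) < (Lam G n).ncard := by
  exact_mod_cast (Set.ncard_pos (Set.toFinite _)).2 ⟨_, none_mem_Lam hnil⟩

lemma omegaCrit_pos_of_mem_Lam (hnil : [] ∉ G) (hG : IsSparse G)
    {c : ColoredSubset (Finset (Fin n)) m} (hc : c ∈ Lam G n) {x : Finset (Fin n)} {i : Fin m}
    (hx : c x = some i) : 0 < omegaCrit G := by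
  have hle := sum_log_le_omegaCrit (T := fun _ => {i}) (R := HasColor c) (B := {x}) hnil hG
    (by simp) (by simp) fun z hz j hj p hp hpz => hc _ hp (occurs_cons.2 ⟨z, by
      rwa [mem_singleton.1 hz, mem_singleton.1 hj], hpz⟩)
  exact (Real.log_pos (by simp)).trans_le ((sum_singleton _ x).symm.trans_le hle)

lemma ncard_Lam_eq_one (hnil : [] ∉ G) (hG : IsSparse G) (hω : omegaCrit G = 0) (n : ℕ) :
    (Lam G n).ncard = 1 := by
  refine Set.ncard_eq_one.2 ⟨fun _ => none, Set.eq_singleton_iff_unique_mem.2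
    ⟨none_mem_Lam hnil, fun c hc => funext fun x => Option.eq_none_iff_forall_ne_some.2
      fun i hx => ?_⟩⟩
  exact (omegaCrit_pos_of_mem_Lam hnil hG hc hx).ne' hω

lemma log_ncard_Lam_div_le (hnil : [] ∉ G) {δ w : ℝ} (hδ : 0 < δ) (hn : 1 ≤ n)
    (hw : ∀ R : Finset (Fin n) → Fin m → Prop,
      Template.omega (container G δ R) ≤ w * n.choose (n / 2)) :
    Real.log (Lam G n).ncard / n.choose (n / 2) ≤
      8 * #(suffixes G) / δ * (Real.log n / √n) + 4 * m / √n + w := by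
  have : 0 ≤ Real.log n := Real.log_nonneg (Nat.one_le_cast.2 hn)
  have hpow := two_pow_div_le_mul_choose_half n
  have hfingerprints : (#(suffixes G) : ℝ) * (2 ^ (n + 1) / (n + 1)) / δ * Real.log n ≤
      8 * #(suffixes G) / δ * (Real.log n / √n) * n.choose (n / 2) := by
    calc (#(suffixes G) : ℝ) * (2 ^ (n + 1) / (n + 1)) / δ * Real.log n
        ≤ (#(suffixes G) : ℝ) * (2 ^ (n + 1) / n) / δ * Real.log n := by
          gcongr
          linarith
      _ = 2 * #(suffixes G) / δ * Real.log n * (2 ^ n / n) := by ring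
      _ ≤ 2 * #(suffixes G) / δ * Real.log n * (4 / √n * n.choose (n / 2)) := by gcongr
      _ = 8 * #(suffixes G) / δ * (Real.log n / √n) * n.choose (n / 2) := by ring
  have hentropy : (m : ℝ) * 2 ^ n / n ≤ 4 * m / √n * n.choose (n / 2) := by
    calc (m : ℝ) * 2 ^ n / n = m * (2 ^ n / n) := mul_div_assoc _ _ _
      _ ≤ m * (4 / √n * n.choose (n / 2)) := by gcongr
      _ = 4 * m / √n * n.choose (n / 2) := by ring
  rw [div_le_iff₀ (choose_half_pos n), add_mul, add_mul]
  exact ((Real.log_le_iff_le_exp (ncard_Lam_pos hnil n)).2 (ncard_Lam_le hδ hn hw)).trans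
    (by gcongr)

lemma eventually_lt_log_ncard_Lam_div (hnil : [] ∉ G) (hG : IsSparse G) {a : ℝ}
    (ha : a < omegaCrit G) :
    ∀ᶠ n : ℕ in atTop, a < Real.log (Lam G n).ncard / n.choose (n / 2) := by
  obtain ⟨r, T, A, hT, hA, hTA, hω⟩ := (isGreatest_omegaCrit hnil hG).1
  have hlim : Tendsto (fun n : ℕ => ∑ x, Real.log (1 + (#(T x) : ℝ)) *
      ((n.choose (n / 2 + #x) : ℝ) / n.choose (n / 2))) atTop (𝓝 (omegaCrit G)) := by
    rw [hω, Template.omega]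
    exact tendsto_finsetSum _ fun x _ => by
      simpa using (tendsto_choose_half_add_div #x).const_mul (Real.log (1 + (#(T x) : ℝ)))
  filter_upwards [hlim.eventually_const_lt ha] with n hn
  refine hn.trans_le ?_
  simp_rw [← mul_div_assoc]
  rw [← sum_div]
  gcongr
  calc ∑ x, Real.log (1 + (#(T x) : ℝ)) * n.choose (n / 2 + #x)
      ≤ (spread T n).omega := sum_log_mul_choose_le_omega_spread hA hTA n
    _ ≤ Real.log (Lam G n).ncard := (Real.le_log_iff_exp_le (ncard_Lam_pos hnil n)).2
      (exp_omega_le_ncard_Lam (hT.not_occurs_spread hA hTA n))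

lemma eventually_log_ncard_Lam_div_lt (hnil : [] ∉ G) (hG : IsSparse G) {a : ℝ}
    (ha : omegaCrit G < a) :
    ∀ᶠ n : ℕ in atTop, Real.log (Lam G n).ncard / n.choose (n / 2) < a := by
  obtain ⟨w, hw, hwa⟩ := exists_between ha
  obtain ⟨δ, hδ, hcontainer⟩ := exists_forall_omega_container_le hnil hG (sub_pos.2 hw)
  rw [add_sub_cancel] at hcontainer
  have hlog : Tendsto (fun n : ℕ => Real.log n / √n) atTop (𝓝 0) := by
    have h := (isLittleO_log_rpow_atTop (one_half_pos (α := ℝ))).tendsto_div_nhds_zero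
    simp_rw [← Real.sqrt_eq_rpow] at h
    exact h.comp tendsto_natCast_atTop_atTop
  have hsqrt : Tendsto (fun n : ℕ => 4 * m / √(n : ℝ)) atTop (𝓝 0) :=
    (Real.tendsto_sqrt_atTop.comp tendsto_natCast_atTop_atTop).const_div_atTop _
  have hlim : Tendsto (fun n : ℕ => 8 * #(suffixes G) / δ * (Real.log n / √n) + 4 * m / √n + w)
      atTop (𝓝 w) := by
    simpa using ((hlog.const_mul (8 * #(suffixes G) / δ)).add hsqrt).add_const w
  filter_upwards [hlim.eventually_lt_const hwa, eventually_ge_atTop 1] with n hn hn1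
  exact (log_ncard_Lam_div_le hnil hδ hn1 (hcontainer n)).trans_lt hn

lemma tendsto_log_ncard_Lam_div (hnil : [] ∉ G) (hG : IsSparse G) :
    Tendsto (fun n : ℕ => Real.log (Lam G n).ncard / n.choose (n / 2)) atTop
      (𝓝 (omegaCrit G)) :=
  tendsto_order.2 ⟨fun _ => eventually_lt_log_ncard_Lam_div hnil hG,
    fun _ => eventually_log_ncard_Lam_div_lt hnil hG⟩

lemma exists_tendsto_zero_eq_exp_mul_one_add {N C : ℕ → ℝ} {w : ℝ} (hN : ∀ n, 0 < N n)
    (hC : ∀ n, C n ≠ 0) (hlim : Tendsto (fun n => Real.log (N n) / C n) atTop (𝓝 w))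
    (hzero : w = 0 → ∀ n, N n = 1) :
    ∃ ε : ℕ → ℝ, Tendsto ε atTop (𝓝 0) ∧ ∀ n, N n = Real.exp (w * C n * (1 + ε n)) := by
  rcases eq_or_ne w 0 with rfl | hw
  · exact ⟨0, tendsto_const_nhds, fun n => by simp [hzero rfl n]⟩
  · refine ⟨fun n => Real.log (N n) / C n / w - 1, ?_, fun n => ?_⟩
    · simpa [hw] using (hlim.div_const w).sub_const 1
    · rw [add_sub_cancel, mul_comm w, mul_assoc, mul_div_cancel₀ _ hw, mul_div_cancel₀ _ (hC n),
        Real.exp_log (hN n)]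

end Asymptotics

end ColoredChains

theorem mainTheorem2 (m : ℕ) (G : Finset (List (Fin m)))
    (hlen : ∀ g ∈ G, 2 ≤ g.length) (hG : ColoredChains.IsSparse G) :
    IsGreatest (ColoredChains.critWeights G) (ColoredChains.omegaCrit G) ∧
    ∃ ε : ℕ → ℝ, Filter.Tendsto ε Filter.atTop (nhds 0) ∧
      ∀ n : ℕ, ((ColoredChains.Lam G n).ncard : ℝ) =
        Real.exp (ColoredChains.omegaCrit G * (n.choose (n / 2) : ℝ) * (1 + ε n)) := by
  open ColoredChains in
  have hnil : [] ∉ G := fun h => absurd (hlen [] h) (by simp)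
  exact ⟨isGreatest_omegaCrit hnil hG, exists_tendsto_zero_eq_exp_mul_one_add
    (ncard_Lam_pos hnil) (fun n => (choose_half_pos n).ne') (tendsto_log_ncard_Lam_div hnil hG)
    fun hω n => by rw [ncard_Lam_eq_one hnil hG hω, Nat.cast_one]⟩
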